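/- Let $f_0,F:\mathbb R^n\times\mathbb R^d\to\mathbb R$ be $C^2$ functions. For $w\in\mathbb R^d$ let $C(w)=\{x\in\mathbb R^n\mid F(x,w)\le 0\}$ and $$S(w)=\{x\in\mathbb R^n\mid 0\in\nabla_xf_0(x,w)+N_{C(w)}(x)\},$$ the stationary point set of the problem of minimizing $f_0(\cdot,w)$ over $C(w)$, where $N_\Omega(x)$ denotes the Mordukhovich (limiting) normal cone: for $x\in\Omega$ it is the set of all limits $\lim_k x_k'$ with $x_k\to x$, $x_k\in\Omega$ and $\limsup_{u\to x_k,\,u\in\Omega}\langle x_k',u-x_k\rangle/\|u-x_k\|\le 0$ for every $k$, and $N_\Omega(x)=\emptyset$ for $x\notin\Omega$. The multifunction $S$ is called locally Lipschitz-like around $(\bar w,\bar x)$, where $\bar x\in S(\bar w)$, if there are $\ell>0$ and neighborhoods $U$ of $\bar x$ and $V$ of $\bar w$ such that $S(w')\cap U\subset S(w)+\ell\|w'-w\|\bar B$ for all $w,w'\in V$, where $\bar B$ is the closed unit ball of $\mathbb R^n$. Let $\bar w\in\mathbb R^d$ and $\bar x\in S(\bar w)$ be such that $F(\bar x,\bar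 w)=0$ and $\nabla_xF(\bar x,\bar w)\ne 0$ (the Mangasarian–Fromovitz constraint qualification). Suppose that the Lagrange multiplier of $\bar x$, i.e. the unique $\lambda\in N_{(-\infty,0]}(F(\bar x,\bar w))=[0,\infty)$ with $\nabla_xf_0(\bar x,\bar w)+\lambda\nabla_xF(\bar x,\bar w)=0$, is $\lambda=0$. All derivatives below are taken at $(\bar x,\bar w)$; $\nabla^2_{wx}f_0$ is the $d\times n$ matrix with entries $\partial^2f_0/\partial w_i\partial x_j$, and in the block matrices $\nabla_xF$ and $\nabla_wF$ are column vectors. Put $$A_1'=[\nabla^2_{xx}f_0\ \ \nabla_xF]\in\mathbb R^{n\times(n+1)},\qquad A_2'=[\nabla^2_{wx}f_0\ \ \nabla_wF]\in\mathbb R^{d\times(n+1)},$$ $$\Delta_1=\{(v,\gamma)\in\mathbb R^n\times\mathbb R\mid\nabla_xF\cdot v>0,\ \gamma\ge 0\},\qquad \Delta_2=\{v\in\mathbb R^n\mid\nabla_xF\cdot v<0\},$$ $$\Delta_3=\{(v,\gamma)\in\mathbb R^n\times\mathbb R\mid\nabla_xF\cdot v\ge 0,\ \gamma\ge 0\},\qquad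 \ker\nabla_xF=\{v\in\mathbb R^n\mid\nabla_xF\cdot v=0\}.$$ (a) If $S$ is locally Lipschitz-like around $(\bar w,\bar x)$, then $\ker A_1'\cap\Delta_3\subset\ker A_2'$. (b) If the four conditions $\ker A_1'\cap\ker A_2'=\{0\}$, $\ \ker A_1'\cap(\ker\nabla_xF\times\mathbb R)\subset\ker A_2'$, $\ \ker A_1'\cap\Delta_1\subset\ker A_2'$ and $\ker\nabla^2_{xx}f_0\cap\Delta_2\subset\ker\nabla^2_{wx}f_0$ all hold, then $S$ is locally Lipschitz-like around $(\bar w,\bar x)$. -/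

import Mathlib

open Filter Topology
open scoped Pointwise RealInnerProductSpace

noncomputable section

/-- The Euclidean space `ℝⁿ`. -/
abbrev Euc (n : ℕ) : Type := EuclideanSpace ℝ (Fin n)

section NormalCones

variable {E : Type*} [NormedAddCommGroup E] [InnerProductSpace ℝ E]

/-- The Fréchet normal cone to `Ω` at `p`: the vectors `p'` with
`limsup ⟪p', q - p⟫ / ‖q - p‖ ≤ 0` as `q → p`, `q ∈ Ω`; it is empty if `p ∉ Ω`. -/
def frechetNormalCone (Ω : Set E) (p : E) : Set E :=
  {p' | p ∈ Ω ∧ ∀ ε > 0, ∀ᶠ q in 𝓝[Ω] p, ⟪p', q - p⟫ ≤ ε * ‖q - p‖}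

/-- The Mordukhovich (limiting) normal cone to `Ω` at `p`; it is empty if `p ∉ Ω`. -/
def limitingNormalCone (Ω : Set E) (p : E) : Set E :=
  {p' | p ∈ Ω ∧ ∃ q q' : ℕ → E, Tendsto q atTop (𝓝 p) ∧ Tendsto q' atTop (𝓝 p') ∧
    ∀ k, q' k ∈ frechetNormalCone Ω (q k)}

end NormalCones

/-- The multifunction `G : Y ⇉ X` is locally Lipschitz-like around `(y₀, x₀)`. -/
def LocallyLipschitzLike {Y X : Type*} [NormedAddCommGroup Y] [NormedAddCommGroup X]
    [NormedSpace ℝ X] (G : Y → Set X) (y₀ : Y) (x₀ : X) : Prop :=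
  ∃ ℓ : ℝ, 0 < ℓ ∧ ∃ U ∈ 𝓝 x₀, ∃ V ∈ 𝓝 y₀, ∀ y ∈ V, ∀ y' ∈ V,
    G y' ∩ U ⊆ G y + (ℓ * ‖y' - y‖) • Metric.closedBall (0 : X) 1

section Problem

variable {n d : ℕ}

/-- The partial gradient `∇ₓ f (x, w) ∈ ℝⁿ`. -/
def gradX (f : Euc n × Euc d → ℝ) (x : Euc n) (w : Euc d) : Euc n :=
  gradient (fun z => f (z, w)) x

/-- The partial gradient `∇_w f (x, w) ∈ ℝᵈ`. -/
def gradW (f : Euc n × Euc d → ℝ) (x : Euc n) (w : Euc d) : Euc d :=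
  gradient (fun u => f (x, u)) w

/-- The Hessian block `∇²ₓₓ f (x, w)`, as an operator on `ℝⁿ`. -/
def hessXX (f : Euc n × Euc d → ℝ) (x : Euc n) (w : Euc d) : Euc n →L[ℝ] Euc n :=
  fderiv ℝ (fun z => gradX f z w) x

/-- The Hessian block `∇²_{wx} f (x, w)`, the `d × n` matrix with entries `∂² f / ∂wᵢ ∂xⱼ`,
as an operator from `ℝⁿ` to `ℝᵈ`. -/
def hessWX (f : Euc n × Euc d → ℝ) (x : Euc n) (w : Euc d) : Euc n →L[ℝ] Euc d :=
  fderiv ℝ (fun z => gradW f z w) x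

/-- The constraint set `C(w) = {x | F (x, w) ≤ 0}`. -/
def constraintSet (F : Euc n × Euc d → ℝ) (w : Euc d) : Set (Euc n) :=
  {x | F (x, w) ≤ 0}

/-- The stationary point set `S(w) = {x | 0 ∈ ∇ₓ f₀ (x, w) + N_{C(w)}(x)}` of the problem of
minimizing `f₀ (·, w)` subject to `F (·, w) ≤ 0`. -/
def stationarySet (f₀ F : Euc n × Euc d → ℝ) (w : Euc d) : Set (Euc n) :=
  {x | (0 : Euc n) ∈ {gradX f₀ x w} + limitingNormalCone (constraintSet F w) x}

/-- `lam` is a Lagrange multiplier for the point `x` of the problem with parameter `w`: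
it lies in the normal cone to `(-∞, 0]` at `F (x, w)` (the subdifferential of the indicator
function), and `∇ₓ f₀ + lam ∇ₓ F = 0` at `(x, w)`. -/
def IsLagrangeMultiplier (f₀ F : Euc n × Euc d → ℝ) (x : Euc n) (w : Euc d) (lam : ℝ) : Prop :=
  lam ∈ limitingNormalCone (Set.Iic (0 : ℝ)) (F (x, w)) ∧
    gradX f₀ x w + lam • gradX F x w = 0

/-- The block operator `A₁' = [∇²ₓₓ f₀, ∇ₓ F] : ℝⁿ × ℝ → ℝⁿ`. -/
def A₁' (f₀ F : Euc n × Euc d → ℝ) (x : Euc n) (w : Euc d) : Euc n × ℝ →L[ℝ] Euc n :=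
  (hessXX f₀ x w).coprod (ContinuousLinearMap.toSpanSingleton ℝ (gradX F x w))

/-- The block operator `A₂' = [∇²_{wx} f₀, ∇_w F] : ℝⁿ × ℝ → ℝᵈ`. -/
def A₂' (f₀ F : Euc n × Euc d → ℝ) (x : Euc n) (w : Euc d) : Euc n × ℝ →L[ℝ] Euc d :=
  (hessWX f₀ x w).coprod (ContinuousLinearMap.toSpanSingleton ℝ (gradW F x w))

/-- The kernel of a linear operator, as a set. -/
def kerSet {E G : Type*} [NormedAddCommGroup E] [NormedSpace ℝ E] [NormedAddCommGroup G]
    [NormedSpace ℝ G] (T : E →L[ℝ] G) : Set E :=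
  {v | T v = 0}

/-- The kernel of `∇ₓ F (x, w)`, regarded as the functional `v ↦ ⟪∇ₓ F (x, w), v⟫`. -/
def kerGradX (F : Euc n × Euc d → ℝ) (x : Euc n) (w : Euc d) : Set (Euc n) :=
  {v | ⟪gradX F x w, v⟫ = 0}

/-- `Δ₁ = {(v, γ) | ∇ₓ F v > 0, γ ≥ 0}`. -/
def Δ₁ (F : Euc n × Euc d → ℝ) (x : Euc n) (w : Euc d) : Set (Euc n × ℝ) :=
  {p | 0 < ⟪gradX F x w, p.1⟫ ∧ 0 ≤ p.2}

/-- `Δ₂ = {v | ∇ₓ F v < 0}`. -/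
def Δ₂ (F : Euc n × Euc d → ℝ) (x : Euc n) (w : Euc d) : Set (Euc n) :=
  {v | ⟪gradX F x w, v⟫ < 0}

/-- `Δ₃ = {(v, γ) | ∇ₓ F v ≥ 0, γ ≥ 0}`. -/
def Δ₃ (F : Euc n × Euc d → ℝ) (x : Euc n) (w : Euc d) : Set (Euc n × ℝ) :=
  {p | 0 ≤ ⟪gradX F x w, p.1⟫ ∧ 0 ≤ p.2}

end Problem

end

/-! A zero multiplier forces `∇ₓf₀ = 0` at the base point. Since `∇ₓF ≠ 0` nearby, points of `S`
satisfy KKT with the multiplier `l` given by a differentiable function of `(x, w)`: `∇ₓf₀ + l ∇ₓF =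
0`, `l ≥ 0`, `F ≤ 0`, `l F = 0`.

(a) For `(v, γ) ∈ ker A₁' ∩ Δ₃`, linearizing `⟪v, ∇ₓf₀⟫ + γ F` at the base point leaves only
`⟪A₂'(v, γ), dw⟫`. On the graph of `S` this expression equals `-l ⟪v, ∇ₓF⟫ + γ F`, which is at most
`o(‖(dx, dw)‖)`. So `(0, A₂'(v, γ))` is a Fréchet normal to the graph (`eventually_inner_A₂'_le`),
and the Lipschitz-like property makes it vanish (`eq_zero_of_locallyLipschitzLike`).

(b) With `H = ∇²ₓₓf₀` and `g = ∇ₓF`, the four conditions make `H` invertible and `c = ⟪g, H⁻¹g⟫ > 0`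
(`exists_hessXX_equiv`). Eliminating `dx` from the linearized equation gives `dF ≈ -c dl`, whereas
complementarity gives `dl dF ≥ 0`; hence KKT pairs depend Lipschitz-continuously on `w`
(`exists_lipschitz_bound`). A nearby KKT pair exists for each `w`, coming either from the
unconstrained system or from the active one. -/

section NormalCones

/-! ### Normal cones of smooth sublevel sets. -/

variable {E : Type*} [NormedAddCommGroup E] [InnerProductSpace ℝ E]

theorem inner_nonpos_of_mem_frechetNormalCone {Ω : Set E} {q p' u : E}
    (hp : p' ∈ frechetNormalCone Ω q) (hu : ∀ᶠ t : ℝ in 𝓝[>] 0, q + t • u ∈ Ω) :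
    ⟪p', u⟫ ≤ 0 := by
  have key : ∀ ε > 0, ⟪p', u⟫ ≤ ε * ‖u‖ := by
    intro ε hε
    have hlim : Tendsto (fun t : ℝ => q + t • u) (𝓝[>] 0) (𝓝[Ω] q) := by
      refine tendsto_nhdsWithin_iff.2 ⟨?_, hu⟩
      have : Tendsto (fun t : ℝ => q + t • u) (𝓝 0) (𝓝 (q + (0 : ℝ) • u)) :=
        Continuous.tendsto (by fun_prop) _
      simpa using this.mono_left nhdsWithin_le_nhds
    obtain ⟨t, ht, ht0⟩ := ((hlim.eventually (hp.2 ε hε)).and self_mem_nhdsWithin).exists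
    have ht0 : 0 < t := ht0
    simp only [add_sub_cancel_left, inner_smul_right, norm_smul, Real.norm_eq_abs,
      abs_of_pos ht0] at ht
    nlinarith
  have hlim : Tendsto (fun ε : ℝ => ε * ‖u‖) (𝓝[>] 0) (𝓝 0) := by
    have : Tendsto (fun ε : ℝ => ε * ‖u‖) (𝓝 0) (𝓝 (0 * ‖u‖)) :=
      Continuous.tendsto (by fun_prop) _
    simpa using this.mono_left nhdsWithin_le_nhds
  exact ge_of_tendsto hlim (eventually_mem_nhdsWithin.mono fun ε hε => key ε hε)

variable [CompleteSpace E]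

/-- Fréchet normals to a smooth sublevel set are nonnegative multiples of the gradient. -/
theorem frechetNormalCone_sublevel {G : E → ℝ} {q g p' : E} (hG : HasGradientAt G g q)
    (hg : g ≠ 0) (hp : p' ∈ frechetNormalCone {z | G z ≤ 0} q) :
    0 ≤ ⟪p', g⟫ / ⟪g, g⟫ ∧ p' = (⟪p', g⟫ / ⟪g, g⟫) • g ∧ ⟪p', g⟫ / ⟪g, g⟫ * G q = 0 := by
  have hgg : 0 < ⟪g, g⟫ := real_inner_self_pos.2 hg
  have hGq : G q ≤ 0 := hp.1
  rcases hGq.lt_or_eq with hlt | heq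
  -- Here `q` is interior, so `p'` is itself a feasible direction and `⟪p', p'⟫ ≤ 0`.
  · have h0 : p' = 0 := by
      refine real_inner_self_nonpos.1 (inner_nonpos_of_mem_frechetNormalCone hp ?_)
      have hlim : Tendsto (fun t : ℝ => q + t • p') (𝓝[>] 0) (𝓝 q) := by
        have : Tendsto (fun t : ℝ => q + t • p') (𝓝 0) (𝓝 (q + (0 : ℝ) • p')) :=
          Continuous.tendsto (by fun_prop) _
        simpa using this.mono_left nhdsWithin_le_nhds
      have := (hlim.eventually (hG.hasFDerivAt.continuousAt.eventually_lt_const hlt))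
      exact this.mono fun t ht => le_of_lt ht
    simp [h0]
  · have key : ∀ u, ⟪g, u⟫ < 0 → ⟪p', u⟫ ≤ 0 := by
      intro u hu
      refine inner_nonpos_of_mem_frechetNormalCone hp ?_
      have hd : HasDerivAt (fun t : ℝ => G (q + t • u)) ⟪g, u⟫ 0 := by
        have h1 : HasDerivAt (fun t : ℝ => q + t • u) u 0 := by
          simpa using ((hasDerivAt_id (0 : ℝ)).smul_const u).const_add q
        have h2 : HasFDerivAt G (InnerProductSpace.toDual ℝ E g) (q + (0 : ℝ) • u) := by
          simpa using hG.hasFDerivAt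
        have h3 := h2.comp_hasDerivAt (0 : ℝ) h1
        rwa [InnerProductSpace.toDual_apply_apply] at h3
      have hs := hd.hasDerivWithinAt (s := Set.Ioi 0)
      rw [hasDerivWithinAt_iff_tendsto_slope' (by simp)] at hs
      filter_upwards [hs.eventually_lt_const hu, self_mem_nhdsWithin] with t ht ht0
      have ht0 : 0 < t := ht0
      simp only [slope_def_field, zero_smul, add_zero, heq, sub_zero] at ht
      rw [div_neg_iff] at ht
      rcases ht with h | h
      · linarith [h.2]
      · exact h.1.le
    set l := ⟪p', g⟫ / ⟪g, g⟫ with hl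
    have hlg : l * ⟪g, g⟫ = ⟪p', g⟫ := div_mul_cancel₀ _ hgg.ne'
    have hnn : 0 ≤ ⟪p', g⟫ := by
      have := key (-g) (by rw [inner_neg_right]; linarith)
      simpa using this
    have hr : ⟪g, p' - l • g⟫ = 0 := by
      rw [inner_sub_right, inner_smul_right, real_inner_comm, hlg, sub_self]
    -- The residual `p' - l • g` is orthogonal to `g`; tilting it by `-δ • g` makes it a strict
    -- descent direction, and then `δ → 0`.
    have hr2 : ∀ δ > 0, ⟪p' - l • g, p' - l • g⟫ ≤ δ * ⟪p', g⟫ := by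
      intro δ hδ
      have h1 := key (p' - l • g - δ • g) (by
        rw [inner_sub_right, hr, inner_smul_right]; nlinarith)
      have h2 : ⟪p' - l • g, p' - l • g⟫ = ⟪p', p' - l • g⟫ := by
        conv_lhs => rw [inner_sub_left, inner_smul_left, hr]
        simp
      rw [inner_sub_right, inner_smul_right] at h1
      linarith
    have hz : p' - l • g = 0 := by
      refine real_inner_self_nonpos.1 ?_
      have hlim : Tendsto (fun ε : ℝ => ε * ⟪p', g⟫) (𝓝[>] 0) (𝓝 0) := by
        have : Tendsto (fun ε : ℝ => ε * ⟪p', g⟫) (𝓝 0) (𝓝 (0 * ⟪p', g⟫)) :=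
          Continuous.tendsto (by fun_prop) _
        simpa using this.mono_left nhdsWithin_le_nhds
      exact ge_of_tendsto hlim (eventually_mem_nhdsWithin.mono fun ε hε => hr2 ε hε)
    exact ⟨div_nonneg hnn hgg.le, sub_eq_zero.1 hz, by rw [heq, mul_zero]⟩

/-- Limiting normals to a smooth sublevel set are nonnegative multiples of the gradient. -/
theorem limitingNormalCone_sublevel {G : E → ℝ} {gr : E → E}
    (hG : ∀ z, HasGradientAt G (gr z) z) (hgr : Continuous gr) {x p' : E} (hg : gr x ≠ 0)
    (hp : p' ∈ limitingNormalCone {z | G z ≤ 0} x) :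
    0 ≤ ⟪p', gr x⟫ / ⟪gr x, gr x⟫ ∧ p' = (⟪p', gr x⟫ / ⟪gr x, gr x⟫) • gr x ∧
      ⟪p', gr x⟫ / ⟪gr x, gr x⟫ * G x = 0 := by
  obtain ⟨-, q, q', hq, hq', hN⟩ := hp
  have hGc : Continuous G := continuous_iff_continuousAt.2 fun z => (hG z).hasFDerivAt.continuousAt
  have hgq : Tendsto (fun k => gr (q k)) atTop (𝓝 (gr x)) := (hgr.tendsto x).comp hq
  have hGq : Tendsto (fun k => G (q k)) atTop (𝓝 (G x)) := (hGc.tendsto x).comp hq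
  have hgg : ⟪gr x, gr x⟫ ≠ 0 := (real_inner_self_pos.2 hg).ne'
  -- The coefficient is an explicit continuous quotient, so it converges along the sequence and no
  -- compactness argument is needed.
  have hl := (hq'.inner hgq).div (hgq.inner hgq) hgg
  have hev := (hgq.eventually_ne hg).mono fun k hk => frechetNormalCone_sublevel (hG (q k)) hk (hN k)
  refine ⟨ge_of_tendsto hl (hev.mono fun k hk => hk.1), ?_, ?_⟩
  · exact tendsto_nhds_unique_of_eventuallyEq hq' (hl.smul hgq) (hev.mono fun k hk => hk.2.1)
  · exact tendsto_nhds_unique_of_eventuallyEq (hl.mul hGq) tendsto_const_nhds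
      (hev.mono fun k hk => hk.2.2)

theorem smul_gradient_mem_limitingNormalCone {G : E → ℝ} {x g : E} (hG : HasGradientAt G g x)
    (hx : G x ≤ 0) {l : ℝ} (hl : 0 ≤ l) (hlG : l * G x = 0) :
    l • g ∈ limitingNormalCone {z | G z ≤ 0} x := by
  refine ⟨hx, fun _ => x, fun _ => l • g, tendsto_const_nhds, tendsto_const_nhds, fun _ => ⟨hx, ?_⟩⟩
  intro ε hε
  have ho : (fun z => l * (G z - G x - ⟪g, z - x⟫)) =o[𝓝 x] fun z => z - x := by
    have := hG.hasFDerivAt.isLittleO.const_mul_left l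
    simpa using this
  filter_upwards [(ho.bound hε).filter_mono nhdsWithin_le_nhds, self_mem_nhdsWithin] with z hz hz0
  have hz0 : G z ≤ 0 := hz0
  rw [Real.norm_eq_abs, abs_le] at hz
  rw [inner_smul_left]
  simp only [conj_trivial]
  nlinarith [hz.1]

end NormalCones

/-! ### Partial gradients and Hessian blocks. -/

section PartialDerivatives

variable {n d : ℕ} {f : Euc n × Euc d → ℝ}

theorem hasGradientAt_gradX (hf : Differentiable ℝ f) (x : Euc n) (w : Euc d) :
    HasGradientAt (fun z => f (z, w)) (gradX f x w) x :=
  DifferentiableAt.hasGradientAt (by fun_prop)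

theorem gradX_eq (hf : Differentiable ℝ f) (p : Euc n × Euc d) :
    gradX f p.1 p.2 = (InnerProductSpace.toDual ℝ (Euc n)).symm
      ((fderiv ℝ f p).comp (ContinuousLinearMap.inl ℝ (Euc n) (Euc d))) := by
  refine HasGradientAt.gradient ?_
  rw [hasGradientAt_iff_hasFDerivAt, LinearIsometryEquiv.apply_symm_apply]
  exact (hf (p.1, p.2)).hasFDerivAt.comp p.1 (hasFDerivAt_prodMk_left p.1 p.2)

theorem gradW_eq (hf : Differentiable ℝ f) (p : Euc n × Euc d) :
    gradW f p.1 p.2 = (InnerProductSpace.toDual ℝ (Euc d)).symm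
      ((fderiv ℝ f p).comp (ContinuousLinearMap.inr ℝ (Euc n) (Euc d))) := by
  refine HasGradientAt.gradient ?_
  rw [hasGradientAt_iff_hasFDerivAt, LinearIsometryEquiv.apply_symm_apply]
  exact (hf (p.1, p.2)).hasFDerivAt.comp p.2 (hasFDerivAt_prodMk_right p.1 p.2)

theorem inner_gradX (hf : Differentiable ℝ f) (p : Euc n × Euc d) (v : Euc n) :
    ⟪gradX f p.1 p.2, v⟫ = fderiv ℝ f p (v, 0) := by
  rw [gradX_eq hf, InnerProductSpace.toDual_symm_apply]; rfl

theorem inner_gradW (hf : Differentiable ℝ f) (p : Euc n × Euc d) (u : Euc d) :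
    ⟪gradW f p.1 p.2, u⟫ = fderiv ℝ f p (0, u) := by
  rw [gradW_eq hf, InnerProductSpace.toDual_symm_apply]; rfl

theorem fderiv_apply_eq_inner (hf : Differentiable ℝ f) (p u : Euc n × Euc d) :
    fderiv ℝ f p u = ⟪gradX f p.1 p.2, u.1⟫ + ⟪gradW f p.1 p.2, u.2⟫ := by
  rw [inner_gradX hf, inner_gradW hf, ← map_add]; simp

theorem contDiff_gradX (hf : ContDiff ℝ 2 f) :
    ContDiff ℝ 1 fun p : Euc n × Euc d => gradX f p.1 p.2 := by
  rw [funext (gradX_eq (hf.differentiable (by norm_num)))]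
  have h : ContDiff ℝ 1 (fderiv ℝ f) := hf.fderiv_right (by norm_num)
  exact (LinearIsometryEquiv.contDiff _).comp (h.clm_comp contDiff_const)

theorem contDiff_gradW (hf : ContDiff ℝ 2 f) :
    ContDiff ℝ 1 fun p : Euc n × Euc d => gradW f p.1 p.2 := by
  rw [funext (gradW_eq (hf.differentiable (by norm_num)))]
  have h : ContDiff ℝ 1 (fderiv ℝ f) := hf.fderiv_right (by norm_num)
  exact (LinearIsometryEquiv.contDiff _).comp (h.clm_comp contDiff_const)

theorem inner_fderiv_gradX (hf : ContDiff ℝ 2 f) (p u : Euc n × Euc d) (v : Euc n) :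
    ⟪fderiv ℝ (fun p : Euc n × Euc d => gradX f p.1 p.2) p u, v⟫ =
      fderiv ℝ (fderiv ℝ f) p u (v, 0) := by
  have h2 : ContDiff ℝ 1 (fderiv ℝ f) := hf.fderiv_right (by norm_num)
  have hA := (((contDiff_gradX hf).differentiable (by norm_num)) p).hasFDerivAt.inner ℝ
    (hasFDerivAt_const v p)
  have hB := ((h2.differentiable (by norm_num)) p).hasFDerivAt.clm_apply
    (hasFDerivAt_const ((v, 0) : Euc n × Euc d) p)
  have := DFunLike.congr_fun
    (hA.unique (hB.congr_of_eventuallyEq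
      (.of_forall fun q => inner_gradX (hf.differentiable (by norm_num)) q v))) u
  simpa using this

theorem inner_fderiv_gradW (hf : ContDiff ℝ 2 f) (p u : Euc n × Euc d) (v : Euc d) :
    ⟪fderiv ℝ (fun p : Euc n × Euc d => gradW f p.1 p.2) p u, v⟫ =
      fderiv ℝ (fderiv ℝ f) p u (0, v) := by
  have h2 : ContDiff ℝ 1 (fderiv ℝ f) := hf.fderiv_right (by norm_num)
  have hA := (((contDiff_gradW hf).differentiable (by norm_num)) p).hasFDerivAt.inner ℝ
    (hasFDerivAt_const v p)
  have hB := ((h2.differentiable (by norm_num)) p).hasFDerivAt.clm_apply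
    (hasFDerivAt_const ((0, v) : Euc n × Euc d) p)
  have := DFunLike.congr_fun
    (hA.unique (hB.congr_of_eventuallyEq
      (.of_forall fun q => inner_gradW (hf.differentiable (by norm_num)) q v))) u
  simpa using this

theorem hessXX_apply (hf : ContDiff ℝ 2 f) (p : Euc n × Euc d) (v : Euc n) :
    hessXX f p.1 p.2 v = fderiv ℝ (fun p : Euc n × Euc d => gradX f p.1 p.2) p (v, 0) := by
  have h : HasFDerivAt (fun p : Euc n × Euc d => gradX f p.1 p.2)
      (fderiv ℝ (fun p : Euc n × Euc d => gradX f p.1 p.2) p) (p.1, p.2) :=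
    (((contDiff_gradX hf).differentiable (by norm_num)) p).hasFDerivAt
  have h' := HasFDerivAt.comp (f := fun z => (z, p.2)) p.1 h (hasFDerivAt_prodMk_left p.1 p.2)
  exact DFunLike.congr_fun h'.fderiv v

theorem hessWX_apply (hf : ContDiff ℝ 2 f) (p : Euc n × Euc d) (v : Euc n) :
    hessWX f p.1 p.2 v = fderiv ℝ (fun p : Euc n × Euc d => gradW f p.1 p.2) p (v, 0) := by
  have h : HasFDerivAt (fun p : Euc n × Euc d => gradW f p.1 p.2)
      (fderiv ℝ (fun p : Euc n × Euc d => gradW f p.1 p.2) p) (p.1, p.2) :=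
    (((contDiff_gradW hf).differentiable (by norm_num)) p).hasFDerivAt
  have h' := HasFDerivAt.comp (f := fun z => (z, p.2)) p.1 h (hasFDerivAt_prodMk_left p.1 p.2)
  exact DFunLike.congr_fun h'.fderiv v

/-- Symmetry of the second derivative transposes the derivative of `∇ₓf` into the blocks that occur
in `A₁'` and `A₂'`. -/
theorem inner_fderiv_gradX_eq (hf : ContDiff ℝ 2 f) (p u : Euc n × Euc d) (v : Euc n) :
    ⟪fderiv ℝ (fun p : Euc n × Euc d => gradX f p.1 p.2) p u, v⟫ =
      ⟪hessXX f p.1 p.2 v, u.1⟫ + ⟪hessWX f p.1 p.2 v, u.2⟫ := by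
  have hs : IsSymmSndFDerivAt ℝ f p := hf.contDiffAt.isSymmSndFDerivAt (by simp)
  rw [inner_fderiv_gradX hf, hs.eq, hessXX_apply hf, hessWX_apply hf, inner_fderiv_gradX hf,
    inner_fderiv_gradW hf, ← map_add]
  simp

end PartialDerivatives

/-! ### KKT description of the stationary set. -/

section Stationarity

variable {n d : ℕ} {f₀ F : Euc n × Euc d → ℝ}

/-- The multiplier determined by `∇ₓ f₀ + lam ∇ₓ F = 0`. -/
noncomputable def multiplier (f₀ F : Euc n × Euc d → ℝ) (p : Euc n × Euc d) : ℝ :=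
  ⟪-gradX f₀ p.1 p.2, gradX F p.1 p.2⟫ / ⟪gradX F p.1 p.2, gradX F p.1 p.2⟫

theorem differentiableAt_multiplier (hf₀ : ContDiff ℝ 2 f₀) (hF : ContDiff ℝ 2 F)
    {p : Euc n × Euc d} (hp : gradX F p.1 p.2 ≠ 0) :
    DifferentiableAt ℝ (multiplier f₀ F) p := by
  have h1 := (contDiff_gradX hf₀).differentiable (by norm_num) p
  have h2 := (contDiff_gradX hF).differentiable (by norm_num) p
  have h3 : DifferentiableAt ℝ (fun q : Euc n × Euc d => ⟪-gradX f₀ q.1 q.2, gradX F q.1 q.2⟫) p :=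
    h1.neg.inner ℝ h2
  have h4 : DifferentiableAt ℝ (fun q : Euc n × Euc d => ⟪gradX F q.1 q.2, gradX F q.1 q.2⟫) p :=
    h2.inner ℝ h2
  exact h3.mul (h4.inv (real_inner_self_pos.2 hp).ne')

theorem kkt_of_mem_stationarySet (hF : ContDiff ℝ 2 F) {x : Euc n} {w : Euc d}
    (hg : gradX F x w ≠ 0) (hx : x ∈ stationarySet f₀ F w) :
    0 ≤ multiplier f₀ F (x, w) ∧
      gradX f₀ x w + multiplier f₀ F (x, w) • gradX F x w = 0 ∧
      F (x, w) ≤ 0 ∧ multiplier f₀ F (x, w) * F (x, w) = 0 := by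
  obtain ⟨a, ha, b, hb, hab⟩ := hx
  rw [Set.mem_singleton_iff] at ha
  subst ha
  have hb' : b = -gradX f₀ x w := (neg_eq_of_add_eq_zero_right hab).symm
  subst hb'
  have hc : Continuous fun z => gradX F z w :=
    (contDiff_gradX hF).continuous.comp (by fun_prop : Continuous fun z : Euc n => (z, w))
  have h := limitingNormalCone_sublevel
    (fun z => hasGradientAt_gradX (hF.differentiable (by norm_num)) z w) hc hg hb
  refine ⟨h.1, ?_, hb.1, h.2.2⟩
  have h2 := h.2.1
  change gradX f₀ x w + (⟪-gradX f₀ x w, gradX F x w⟫ / ⟪gradX F x w, gradX F x w⟫) •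
    gradX F x w = 0
  rw [← h2, add_neg_cancel]

theorem mem_stationarySet_of_kkt (hF : Differentiable ℝ F) {x : Euc n} {w : Euc d} {l : ℝ}
    (hl : 0 ≤ l) (hst : gradX f₀ x w + l • gradX F x w = 0) (hFx : F (x, w) ≤ 0)
    (hlF : l * F (x, w) = 0) : x ∈ stationarySet f₀ F w :=
  ⟨_, rfl, l • gradX F x w,
    smul_gradient_mem_limitingNormalCone (hasGradientAt_gradX hF x w) hFx hl hlF, hst⟩

end Stationarity

/-! ### Part (a): Fréchet normals to the graph. -/

section Necessity

open Asymptotics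

variable {n d : ℕ} {f₀ F : Euc n × Euc d → ℝ}

/-- `(0, A₂' (v, γ))` is a Fréchet normal to the graph of the stationary point multifunction. -/
theorem eventually_inner_A₂'_le (hf₀ : ContDiff ℝ 2 f₀) (hF : ContDiff ℝ 2 F)
    {p₀ : Euc n × Euc d} (hg : gradX F p₀.1 p₀.2 ≠ 0) (h0 : gradX f₀ p₀.1 p₀.2 = 0)
    (hF0 : F p₀ = 0) {a : Euc n × ℝ} (ha : a ∈ kerSet (A₁' f₀ F p₀.1 p₀.2))
    (ha3 : a ∈ Δ₃ F p₀.1 p₀.2) {ε : ℝ} (hε : 0 < ε) :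
    ∀ᶠ p in 𝓝 p₀, p.1 ∈ stationarySet f₀ F p.2 →
      ⟪A₂' f₀ F p₀.1 p₀.2 a, p.2 - p₀.2⟫ ≤ ε * ‖p - p₀‖ := by
  obtain ⟨v, γ⟩ := a
  have hFd : Differentiable ℝ F := hF.differentiable (by norm_num)
  set D := fderiv ℝ (fun p : Euc n × Euc d => gradX f₀ p.1 p.2) p₀ with hD
  have hGX : DifferentiableAt ℝ (fun p : Euc n × Euc d => gradX f₀ p.1 p.2) p₀ :=
    (contDiff_gradX hf₀).differentiable (by norm_num) p₀
  have hgc : ContinuousAt (fun p : Euc n × Euc d => gradX F p.1 p.2) p₀ :=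
    (contDiff_gradX hF).continuous.continuousAt
  have hm0 : multiplier f₀ F p₀ = 0 := by simp [multiplier, h0]
  have o1 : (fun p : Euc n × Euc d => ⟪v, gradX f₀ p.1 p.2 - D (p - p₀)⟫)
      =o[𝓝 p₀] fun p => p - p₀ := by
    have h := hGX.hasFDerivAt.isLittleO
    simp only [h0, sub_zero] at h
    exact ((innerSL ℝ v).isBigO_comp _ _).trans_isLittleO h
  have o2 : (fun p : Euc n × Euc d => γ * (F p - fderiv ℝ F p₀ (p - p₀)))
      =o[𝓝 p₀] fun p => p - p₀ := by
    have h := (hFd p₀).hasFDerivAt.isLittleO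
    simp only [hF0, sub_zero] at h
    exact h.const_mul_left γ
  -- The multiplier vanishes at `p₀`, hence is `O(p - p₀)`; the other factor tends to `0`.
  have o3 : (fun p : Euc n × Euc d => multiplier f₀ F p *
      ⟪v, gradX F p.1 p.2 - gradX F p₀.1 p₀.2⟫) =o[𝓝 p₀] fun p => p - p₀ := by
    have h1 := (differentiableAt_multiplier hf₀ hF hg).hasFDerivAt.isBigO_sub
    simp only [hm0, sub_zero] at h1
    have h2 : (fun p : Euc n × Euc d => ⟪v, gradX F p.1 p.2 - gradX F p₀.1 p₀.2⟫)
        =o[𝓝 p₀] fun _ => (1 : ℝ) := by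
      rw [isLittleO_one_iff]
      have : Tendsto (fun p : Euc n × Euc d => ⟪v, gradX F p.1 p.2 - gradX F p₀.1 p₀.2⟫)
          (𝓝 p₀) (𝓝 ⟪v, gradX F p₀.1 p₀.2 - gradX F p₀.1 p₀.2⟫) :=
        (tendsto_const_nhds (x := v)).inner (hgc.tendsto.sub_const _)
      simpa using this
    refine IsLittleO.of_norm_right ?_
    simpa using h1.norm_right.mul_isLittleO h2
  filter_upwards [((o1.add o2).add o3).neg_left.bound hε, hgc.eventually_ne hg] with p hp hgp hS
  obtain ⟨hl, hst, hFp, hlF⟩ := kkt_of_mem_stationarySet hF hgp hS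
  have hker : hessXX f₀ p₀.1 p₀.2 v + γ • gradX F p₀.1 p₀.2 = 0 := by
    simpa [kerSet, A₁'] using ha
  have e1 := inner_fderiv_gradX_eq hf₀ p₀ (p - p₀) v
  have e2 := fderiv_apply_eq_inner hFd p₀ (p - p₀)
  have e3 : ⟪hessXX f₀ p₀.1 p₀.2 v, p.1 - p₀.1⟫ + γ * ⟪gradX F p₀.1 p₀.2, p.1 - p₀.1⟫ = 0 := by
    have := congrArg (fun y => ⟪y, p.1 - p₀.1⟫) hker
    simpa [inner_add_left, inner_smul_left] using this
  have e4 : ⟪v, gradX f₀ p.1 p.2⟫ + multiplier f₀ F p * ⟪v, gradX F p.1 p.2⟫ = 0 := by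
    have := congrArg (fun y => ⟪v, y⟫) hst
    simpa [inner_add_right, inner_smul_right] using this
  have e5 : ⟪A₂' f₀ F p₀.1 p₀.2 (v, γ), p.2 - p₀.2⟫ =
      ⟪hessWX f₀ p₀.1 p₀.2 v, p.2 - p₀.2⟫ + γ * ⟪gradW F p₀.1 p₀.2, p.2 - p₀.2⟫ := by
    simp [A₂', inner_add_left, inner_smul_left]
  have hb := (le_abs_self _).trans hp
  rw [inner_sub_right, inner_sub_right] at hb
  rw [e5]
  have hv : 0 ≤ ⟪v, gradX F p₀.1 p₀.2⟫ := by rw [real_inner_comm]; exact ha3.1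
  have hγ : 0 ≤ γ := ha3.2
  rw [← hD] at e1
  simp only [Prod.fst_sub, Prod.snd_sub] at e1 e2
  have hl' : 0 ≤ multiplier f₀ F p := hl
  have hFp' : F p ≤ 0 := hFp
  rw [real_inner_comm] at e1
  rw [e1, e2] at hb
  nlinarith [mul_nonneg hl' hv, mul_nonneg hγ (neg_nonneg.2 hFp')]

theorem mem_add_smul_closedBall_iff {X : Type*} [NormedAddCommGroup X] [NormedSpace ℝ X]
    {A : Set X} {r : ℝ} (hr : 0 ≤ r) {x : X} :
    x ∈ A + r • Metric.closedBall (0 : X) 1 ↔ ∃ y ∈ A, ‖x - y‖ ≤ r := by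
  rw [smul_unitClosedBall, Real.norm_of_nonneg hr]
  constructor
  · rintro ⟨y, hy, b, hb, rfl⟩
    exact ⟨y, hy, by simpa using hb⟩
  · rintro ⟨y, hy, h⟩
    exact ⟨y, hy, x - y, by simpa using h, by simp⟩

/-- A locally Lipschitz-like multifunction has no nonzero Fréchet coderivative at `0`. -/
theorem eq_zero_of_locallyLipschitzLike {X Y : Type*} [NormedAddCommGroup X] [NormedSpace ℝ X]
    [NormedAddCommGroup Y] [InnerProductSpace ℝ Y] {G : Y → Set X} {x₀ : X} {y₀ y' : Y}
    (hG : LocallyLipschitzLike G y₀ x₀) (hx : x₀ ∈ G y₀)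
    (hy : ∀ ε > 0, ∀ᶠ p : X × Y in 𝓝 (x₀, y₀), p.1 ∈ G p.2 →
      ⟪y', p.2 - y₀⟫ ≤ ε * ‖p - (x₀, y₀)‖) : y' = 0 := by
  obtain ⟨ℓ, hℓ, U, hU, V, hV, h⟩ := hG
  by_contra hne
  have hpos : 0 < ‖y'‖ := norm_pos_iff.2 hne
  -- Moving the parameter by `t • y'` moves the graph point by at most `(ℓ + 1) t ‖y'‖`; this `ε`
  -- turns the normal inequality into `t ‖y'‖² ≤ t ‖y'‖² / 2`.
  set ε := ‖y'‖ / (2 * (ℓ + 1)) with hεdef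
  have hε : 0 < ε := by positivity
  obtain ⟨δ, hδ, hball⟩ := Metric.eventually_nhds_iff.1 (hy ε hε)
  have ht : Tendsto (fun t : ℝ => y₀ + t • y') (𝓝[>] 0) (𝓝 y₀) := by
    have : Tendsto (fun t : ℝ => y₀ + t • y') (𝓝 0) (𝓝 (y₀ + (0 : ℝ) • y')) :=
      Continuous.tendsto (by fun_prop) _
    simpa using this.mono_left nhdsWithin_le_nhds
  have hsmall : ∀ᶠ t : ℝ in 𝓝[>] 0, (ℓ + 1) * (t * ‖y'‖) < δ := by
    have : Tendsto (fun t : ℝ => (ℓ + 1) * (t * ‖y'‖)) (𝓝 0) (𝓝 ((ℓ + 1) * (0 * ‖y'‖))) :=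
      Continuous.tendsto (by fun_prop) _
    rw [zero_mul, mul_zero] at this
    exact (this.mono_left nhdsWithin_le_nhds).eventually_lt_const hδ
  obtain ⟨t, ⟨htV, htδ⟩, ht0⟩ := ((ht.eventually_mem hV).and hsmall |>.and
    self_mem_nhdsWithin).exists
  have ht0 : 0 < t := ht0
  have hsub := h _ htV _ (mem_of_mem_nhds hV) ⟨hx, mem_of_mem_nhds hU⟩
  rw [mem_add_smul_closedBall_iff (by positivity)] at hsub
  obtain ⟨x, hxG, hxn⟩ := hsub
  have hn : ‖y₀ - (y₀ + t • y')‖ = t * ‖y'‖ := by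
    rw [sub_add_cancel_left, norm_neg, norm_smul, Real.norm_of_nonneg ht0.le]
  rw [hn, norm_sub_rev] at hxn
  have hd : ‖((x, y₀ + t • y') : X × Y) - (x₀, y₀)‖ ≤ (ℓ + 1) * (t * ‖y'‖) := by
    have : 0 ≤ t * ‖y'‖ := by positivity
    rw [Prod.mk_sub_mk, Prod.norm_mk, norm_sub_rev (y₀ + t • y'), hn]
    refine max_le (hxn.trans ?_) ?_ <;> nlinarith
  have hfin := hball (y := (x, y₀ + t • y')) (by rw [dist_eq_norm]; exact hd.trans_lt htδ) hxG
  simp only [add_sub_cancel_left, inner_smul_right, real_inner_self_eq_norm_sq] at hfin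
  have h2 := hfin.trans (mul_le_mul_of_nonneg_left hd hε.le)
  have h3 : ε * ((ℓ + 1) * (t * ‖y'‖)) = t * ‖y'‖ ^ 2 / 2 := by
    rw [hεdef]; field_simp
  have : 0 < t * ‖y'‖ ^ 2 := by positivity
  linarith

end Necessity

/-! ### Part (b): solvability and Lipschitz estimates. -/

section Sufficiency

/-- Solvability of a parametric equation with a surjective partial derivative. -/
theorem HasStrictFDerivAt.eventually_exists_eq_zero {X W Y : Type*}
    [NormedAddCommGroup X] [NormedSpace ℝ X] [CompleteSpace X]
    [NormedAddCommGroup W] [NormedSpace ℝ W] [CompleteSpace W]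
    [NormedAddCommGroup Y] [NormedSpace ℝ Y] [CompleteSpace Y]
    {f : X × W → Y} {f' : X × W →L[ℝ] Y} {x₀ : X} {w₀ : W}
    (hf : HasStrictFDerivAt f f' (x₀, w₀)) (hsurj : ∀ y, ∃ v, f' (v, 0) = y)
    (h0 : f (x₀, w₀) = 0) {U : Set X} (hU : U ∈ 𝓝 x₀) :
    ∀ᶠ w in 𝓝 w₀, ∃ x ∈ U, f (x, w) = 0 := by
  -- The map `(x, w) ↦ (f (x, w), w)` has surjective derivative, so it is open at the base point,
  -- and its local image contains `(0, w)` for `w` near `w₀`.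
  have hmap := (hf.prodMk (hasStrictFDerivAt_snd (𝕜 := ℝ) (p := (x₀, w₀)))).map_nhds_eq_of_surj (by
    rw [LinearMap.range_eq_top]
    rintro ⟨y, w⟩
    obtain ⟨v, hv⟩ := hsurj (y - f' (0, w))
    refine ⟨(v, w), Prod.ext ?_ rfl⟩
    change f' (v, w) = y
    have : ((v, w) : X × W) = (v, 0) + (0, w) := by simp
    rw [this, map_add, hv, sub_add_cancel])
  have hA : Prod.fst ⁻¹' U ∈ 𝓝 (x₀, w₀) := continuousAt_fst.preimage_mem_nhds hU
  have himg := image_mem_map (m := fun p : X × W => (f p, p.2)) hA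
  rw [hmap, h0] at himg
  have hlim : Tendsto (fun w : W => ((0 : Y), w)) (𝓝 w₀) (𝓝 (0, w₀)) :=
    Continuous.tendsto (by fun_prop) _
  filter_upwards [hlim.eventually_mem himg] with w ⟨⟨x, w'⟩, hx, hxw⟩
  obtain ⟨h1, rfl⟩ := Prod.mk.inj hxw
  exact ⟨x, hx, h1⟩

set_option maxHeartbeats 1000000 in
/-- Lipschitz stability of the solutions `(x, l)` of a perturbed variational system whose
linearization satisfies `0 < ⟪g, H⁻¹ g⟫`. -/
theorem exists_lipschitz_bound {X W : Type*} [NormedAddCommGroup X] [InnerProductSpace ℝ X]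
    [NormedAddCommGroup W] [NormedSpace ℝ W]
    {M : (X × ℝ) × W → X} {Φ : (X × ℝ) × W → ℝ} {M' : (X × ℝ) × W →L[ℝ] X}
    {Φ' : (X × ℝ) × W →L[ℝ] ℝ} {z₀ : (X × ℝ) × W}
    (hM : HasStrictFDerivAt M M' z₀) (hΦ : HasStrictFDerivAt Φ Φ' z₀)
    (H : X ≃L[ℝ] X) (g : X) (hM' : ∀ v γ, M' ((v, γ), 0) = H v + γ • g)
    (hΦ' : ∀ v γ, Φ' ((v, γ), 0) = ⟪g, v⟫) (hc : 0 < ⟪g, H.symm g⟫) :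
    ∃ ℓ > 0, ∃ N ∈ 𝓝 z₀, ∀ z ∈ N, ∀ z' ∈ N, M z = 0 → M z' = 0 →
      0 ≤ (z.1.2 - z'.1.2) * (Φ z - Φ z') → ‖z.1 - z'.1‖ ≤ ℓ * ‖z.2 - z'.2‖ := by
  set c := ⟪g, H.symm g⟫ with hcdef
  set a := ‖(H.symm : X →L[ℝ] X)‖ with hadef
  -- In the final estimate `s ≤ Q ε s + P ‖dw‖`, the choice of `ε` gives `Q ε ≤ 1/2`, so the `s`
  -- term is absorbed.
  set Q := (‖H.symm g‖ + 1) / c * (‖g‖ * a + 1) + a with hQ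
  have ha0 : 0 ≤ a := norm_nonneg _
  have hQ0 : 0 ≤ Q := by positivity
  set ε := 1 / (2 * (Q + 1)) with hεdef
  have hε : 0 < ε := by positivity
  set P := (‖H.symm g‖ + 1) / c * (‖g‖ * (a * (‖M'‖ + ε)) + (‖Φ'‖ + ε)) + a * (‖M'‖ + ε) with hP
  have hP0 : 0 ≤ P := by positivity
  have hev := (hM.isLittleO.bound hε).and (hΦ.isLittleO.bound hε)
  rw [nhds_prod_eq] at hev
  obtain ⟨N, hN, hev⟩ := mem_prod_self_iff.1 hev
  refine ⟨2 * P + 1, by positivity, N, hN, fun z hz z' hz' h1 h2 h3 => ?_⟩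
  obtain ⟨b1, b2⟩ := hev (Set.mk_mem_prod hz hz')
  simp only [h1, h2, sub_zero, zero_sub, norm_neg] at b1
  set dx := z.1.1 - z'.1.1 with hdx
  set dl := z.1.2 - z'.1.2 with hdl
  set dw := z.2 - z'.2 with hdw
  have hdz : z - z' = ((dx, dl), 0) + ((0, 0), dw) := by ext <;> simp [hdx, hdl, hdw]
  have hn0 : ‖(((0, 0), dw) : (X × ℝ) × W)‖ = ‖dw‖ := by simp [Prod.norm_def]
  have hs : ‖z.1 - z'.1‖ ≤ ‖dx‖ + |dl| :=
    max_le (le_add_of_nonneg_right (abs_nonneg _)) (le_add_of_nonneg_left (norm_nonneg _))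
  set s := ‖z.1 - z'.1‖ with hsdef
  have hs0 : 0 ≤ s := norm_nonneg _
  have hzn : ‖z - z'‖ ≤ s + ‖dw‖ :=
    max_le (le_add_of_nonneg_right (norm_nonneg _)) (le_add_of_nonneg_left (norm_nonneg _))
  have hεz : ε * ‖z - z'‖ ≤ ε * (s + ‖dw‖) := mul_le_mul_of_nonneg_left hzn hε.le
  set e := M' (z - z') with he
  set y := H.symm (M' ((0, 0), dw) - e) with hy
  have hyn : ‖y‖ ≤ a * (‖M'‖ * ‖dw‖ + ε * (s + ‖dw‖)) := by
    refine ((H.symm : X →L[ℝ] X).le_opNorm _).trans (mul_le_mul_of_nonneg_left ?_ ha0)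
    refine (norm_sub_le _ _).trans (add_le_add ?_ (b1.trans hεz))
    simpa only [hn0] using M'.le_opNorm ((0, 0), dw)
  have hdx2 : dx = -(dl • H.symm g + y) := by
    have h4 : e = H dx + dl • g + M' ((0, 0), dw) := by rw [he, hdz, map_add, hM']
    have h5 := congrArg H.symm h4
    simp only [map_add, map_smul, ContinuousLinearEquiv.symm_apply_apply] at h5
    rw [hy, map_sub, h5]
    abel
  have hdxn : ‖dx‖ ≤ |dl| * ‖H.symm g‖ + ‖y‖ := by
    rw [hdx2, norm_neg]
    refine (norm_add_le _ _).trans ?_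
    rw [norm_smul, Real.norm_eq_abs]
  set r := (Φ z - Φ z') + c * dl with hr
  have hrn : |r| ≤ ‖g‖ * ‖y‖ + ‖Φ'‖ * ‖dw‖ + ε * (s + ‖dw‖) := by
    have h4 : Φ' (z - z') = ⟪g, dx⟫ + Φ' ((0, 0), dw) := by rw [hdz, map_add, hΦ']
    have h5 : ⟪g, dx⟫ = -(dl * c) - ⟪g, y⟫ := by
      rw [hdx2, inner_neg_right, inner_add_right, inner_smul_right]; ring
    have h6 : r = (Φ z - Φ z' - Φ' (z - z')) - ⟪g, y⟫ + Φ' ((0, 0), dw) := by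
      rw [h4, h5, hr]; ring
    have h7 : |Φ' ((0, 0), dw)| ≤ ‖Φ'‖ * ‖dw‖ := by
      simpa only [hn0, Real.norm_eq_abs] using Φ'.le_opNorm ((0, 0), dw)
    have h8 := abs_real_inner_le_norm g y
    rw [h6]
    have h9 := b2.trans hεz
    rw [Real.norm_eq_abs] at h9
    rw [abs_le] at h7 h8 h9 ⊢
    constructor <;> linarith [h7.1, h7.2, h8.1, h8.2, h9.1, h9.2]
  -- The monotonicity hypothesis `dl (Φ z - Φ z') ≥ 0` yields `c dl² ≤ dl r`.
  have hdln : |dl| ≤ |r| / c := by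
    rw [le_div_iff₀ hc]
    have h4 : c * |dl| ^ 2 ≤ |dl| * |r| := by
      rw [sq_abs, ← abs_mul]
      refine le_trans ?_ (le_abs_self _)
      rw [hr]; nlinarith
    rcases (abs_nonneg dl).eq_or_lt with h5 | h5
    · rw [← h5]; simp
    · nlinarith
  have hfin : s ≤ Q * ε * s + P * ‖dw‖ := by
    have hZ : 0 ≤ (‖H.symm g‖ + 1) / c := by positivity
    calc s ≤ |dl| * (‖H.symm g‖ + 1) + ‖y‖ := by linarith
      _ ≤ |r| / c * (‖H.symm g‖ + 1) + ‖y‖ := by gcongr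
      _ = (‖H.symm g‖ + 1) / c * |r| + ‖y‖ := by ring
      _ ≤ (‖H.symm g‖ + 1) / c * (‖g‖ * (a * (‖M'‖ * ‖dw‖ + ε * (s + ‖dw‖)))
            + ‖Φ'‖ * ‖dw‖ + ε * (s + ‖dw‖)) + a * (‖M'‖ * ‖dw‖ + ε * (s + ‖dw‖)) := by
          gcongr
          exact hrn.trans (by gcongr)
      _ = Q * ε * s + P * ‖dw‖ := by rw [hQ, hP]; ring
  have hQε : Q * ε ≤ 1 / 2 := by
    rw [hεdef, mul_one_div, div_le_div_iff₀ (by positivity) (by norm_num)]; linarith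
  nlinarith [norm_nonneg dw]

end Sufficiency

/-! ### Part (b): the stationary set. -/

section Sufficiency

variable {n d : ℕ} {f₀ F : Euc n × Euc d → ℝ}

/-- The KKT conditions make the stationary point multifunction locally Lipschitz-like as soon as
the Hessian is invertible and `0 < ⟪∇ₓ F, (∇²ₓₓ f₀)⁻¹ ∇ₓ F⟫`. -/
theorem locallyLipschitzLike_stationarySet (hf₀ : ContDiff ℝ 2 f₀) (hF : ContDiff ℝ 2 F)
    {xb : Euc n} {wb : Euc d} (hg : gradX F xb wb ≠ 0) (h0 : gradX f₀ xb wb = 0)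
    (hF0 : F (xb, wb) = 0) (H : Euc n ≃L[ℝ] Euc n) (hH : ∀ v, H v = hessXX f₀ xb wb v)
    (hc : 0 < ⟪gradX F xb wb, H.symm (gradX F xb wb)⟫) :
    LocallyLipschitzLike (stationarySet f₀ F) wb xb := by
  set g := gradX F xb wb with hgdef
  have hFd : Differentiable ℝ F := hF.differentiable (by norm_num)
  have hX0 : HasStrictFDerivAt (fun p : Euc n × Euc d => gradX f₀ p.1 p.2) _ (xb, wb) :=
    (contDiff_gradX hf₀).contDiffAt.hasStrictFDerivAt (by norm_num)
  set D₀ := fderiv ℝ (fun p : Euc n × Euc d => gradX f₀ p.1 p.2) (xb, wb) with hD₀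
  have hX1 : HasStrictFDerivAt (fun p : Euc n × Euc d => gradX F p.1 p.2) _ (xb, wb) :=
    (contDiff_gradX hF).contDiffAt.hasStrictFDerivAt (by norm_num)
  have hFs : HasStrictFDerivAt F _ (xb, wb) := hF.contDiffAt.hasStrictFDerivAt (by norm_num)
  set z₀ : (Euc n × ℝ) × Euc d := ((xb, 0), wb) with hz₀
  have hfst : HasStrictFDerivAt (fun z : (Euc n × ℝ) × Euc d => z.1) _ z₀ :=
    hasStrictFDerivAt_fst (𝕜 := ℝ)
  have hsnd : HasStrictFDerivAt (fun z : (Euc n × ℝ) × Euc d => z.2) _ z₀ :=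
    hasStrictFDerivAt_snd (𝕜 := ℝ)
  have hπ : HasStrictFDerivAt (fun z : (Euc n × ℝ) × Euc d => (z.1.1, z.2)) _ z₀ :=
    hfst.fst.prodMk hsnd
  have hΦ : HasStrictFDerivAt (fun z : (Euc n × ℝ) × Euc d => F (z.1.1, z.2)) _ z₀ :=
    HasStrictFDerivAt.comp (g := F) z₀ hFs hπ
  have hM0 : HasStrictFDerivAt (fun z : (Euc n × ℝ) × Euc d => gradX f₀ z.1.1 z.2) _ z₀ :=
    HasStrictFDerivAt.comp (g := fun p : Euc n × Euc d => gradX f₀ p.1 p.2) z₀ hX0 hπ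
  have hM1 : HasStrictFDerivAt (fun z : (Euc n × ℝ) × Euc d => gradX F z.1.1 z.2) _ z₀ :=
    HasStrictFDerivAt.comp (g := fun p : Euc n × Euc d => gradX F p.1 p.2) z₀ hX1 hπ
  have hM : HasStrictFDerivAt (fun z : (Euc n × ℝ) × Euc d =>
      gradX f₀ z.1.1 z.2 + z.1.2 • gradX F z.1.1 z.2) _ z₀ := hM0.add (hfst.snd.smul hM1)
  have hD₀H : ∀ v, D₀ (v, 0) = H v := fun v => by
    rw [hH, hD₀]; exact (hessXX_apply hf₀ (xb, wb) v).symm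
  have hD₁ : ∀ v, fderiv ℝ F (xb, wb) (v, 0) = ⟪g, v⟫ := fun v =>
    (inner_gradX hFd (xb, wb) v).symm
  obtain ⟨ℓ, hℓ, N, hN, hkey⟩ := exists_lipschitz_bound hM hΦ H g
    (fun v γ => by simp [hz₀, hD₀H, ← hgdef]) (fun v γ => by simp [hD₁]) hc
  obtain ⟨U₀, hU₀, V₀, hV₀, hUV⟩ := mem_nhds_prod_iff.1 hN
  have hex₂ : ∀ᶠ w in 𝓝 wb, ∃ a ∈ U₀,
      (gradX f₀ a.1 w + a.2 • gradX F a.1 w, F (a.1, w)) = 0 := by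
    refine (hM.prodMk hΦ).eventually_exists_eq_zero ?_ (by simp [h0, hF0]) hU₀
    rintro ⟨y, t⟩
    set c := ⟪g, H.symm g⟫ with hcdef
    -- Chosen so that `H⁻¹y - l H⁻¹g` has inner product `t` with `g`.
    set l := (⟪g, H.symm y⟫ - t) / c with hl
    have hlc : l * c = ⟪g, H.symm y⟫ - t := div_mul_cancel₀ _ hc.ne'
    refine ⟨(H.symm y - l • H.symm g, l), Prod.ext ?_ ?_⟩
    · simp [hz₀, hD₀H, ← hgdef]
    · simp only [ContinuousLinearMap.prod_apply, ContinuousLinearMap.comp_apply,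
        ContinuousLinearMap.coe_fst', ContinuousLinearMap.coe_snd', hD₁, inner_sub_right,
        inner_smul_right, ← hcdef, hlc]
      ring
  have hex₁ : ∀ᶠ w in 𝓝 wb, ∃ x ∈ (fun x : Euc n => (x, (0 : ℝ))) ⁻¹' U₀, gradX f₀ x w = 0 := by
    refine hX0.eventually_exists_eq_zero (fun y => ⟨H.symm y, by rw [hD₀H]; simp⟩) h0 ?_
    exact (Continuous.continuousAt (by fun_prop)).preimage_mem_nhds hU₀
  have hex : ∀ᶠ w in 𝓝 wb, ∃ a ∈ U₀, gradX f₀ a.1 w + a.2 • gradX F a.1 w = 0 ∧ 0 ≤ a.2 ∧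
      F (a.1, w) ≤ 0 ∧ a.2 * F (a.1, w) = 0 := by
    filter_upwards [hex₁, hex₂, hV₀] with w ⟨x, hxU, hx⟩ ⟨a, haU, ha⟩ hw
    obtain ⟨ha1, ha2⟩ := Prod.mk.inj ha
    rcases le_or_gt 0 a.2 with hla | hla
    · exact ⟨a, haU, ha1, hla, ha2.le, by rw [ha2, mul_zero]⟩
    -- If the active solution has `a.2 < 0`, the unconstrained one is feasible: were `F (x, w) > 0`,
    -- the monotonicity condition would hold for the two pairs, and the bound at equal parameters
    -- would identify them, giving `a.2 = 0`.
    · refine ⟨(x, 0), hxU, by simp [hx], le_rfl, ?_, by simp⟩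
      by_contra hpos
      have hpos : 0 < F (x, w) := not_le.1 hpos
      have h := hkey ((x, 0), w) (hUV ⟨hxU, hw⟩) (a, w) (hUV ⟨haU, hw⟩) (by simp [hx]) ha1 (by
        simp only [ha2]; nlinarith)
      rw [sub_self, norm_zero, mul_zero] at h
      have h' := congrArg Prod.snd (sub_eq_zero.1 (norm_le_zero_iff.1 h))
      exact hla.ne h'.symm
  have hmul : ContinuousAt (multiplier f₀ F) (xb, wb) :=
    (differentiableAt_multiplier hf₀ hF hg).continuousAt
  have hm0 : multiplier f₀ F (xb, wb) = 0 := by simp [multiplier, h0]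
  have hnear : ∀ᶠ p in 𝓝 (xb, wb), gradX F p.1 p.2 ≠ 0 ∧ (p.1, multiplier f₀ F p) ∈ U₀ := by
    refine Eventually.and ?_ ?_
    · exact (contDiff_gradX hF).continuous.continuousAt.eventually_ne hg
    · have : Tendsto (fun p => (p.1, multiplier f₀ F p)) (𝓝 (xb, wb)) (𝓝 (xb, 0)) :=
        Tendsto.prodMk_nhds continuousAt_fst (by simpa only [hm0] using hmul.tendsto)
      exact this.eventually_mem hU₀
  rw [nhds_prod_eq, eventually_prod_iff] at hnear
  obtain ⟨pU, hpU, pV, hpV, hnear⟩ := hnear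
  refine ⟨ℓ, hℓ, {x | pU x}, hpU, _, (hpV.and hex).and hV₀, ?_⟩
  rintro w ⟨⟨-, a, haU, ha1, ha2, ha3, ha4⟩, hwV⟩ w' ⟨⟨hw', -⟩, hwV'⟩ x ⟨hxS, hxU⟩
  rw [mem_add_smul_closedBall_iff (by positivity)]
  obtain ⟨hgx, hxU₀⟩ := hnear hxU hw'
  obtain ⟨h1, h2, h3, h4⟩ := kkt_of_mem_stationarySet hF hgx hxS
  refine ⟨a.1, mem_stationarySet_of_kkt hFd ha2 ha1 ha3 ha4, ?_⟩
  refine (norm_fst_le _).trans (hkey ((x, multiplier f₀ F (x, w')), w') (hUV ⟨hxU₀, hwV'⟩)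
    (a, w) (hUV ⟨haU, hwV⟩) h2 ha1 ?_)
  dsimp only
  -- By complementarity the product equals `-l F (a.1, w) - a.2 F (x, w')`, a sum of nonnegative
  -- terms.
  nlinarith [mul_nonneg h1 (neg_nonneg.2 ha3), mul_nonneg ha2 (neg_nonneg.2 h3)]

/-- The four kernel conditions say that the Hessian is invertible and
`0 < ⟪∇ₓ F, (∇²ₓₓ f₀)⁻¹ ∇ₓ F⟫`. -/
theorem exists_hessXX_equiv {x : Euc n} {w : Euc d}
    (h1 : kerSet (A₁' f₀ F x w) ∩ kerSet (A₂' f₀ F x w) = {0})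
    (h2 : kerSet (A₁' f₀ F x w) ∩ (kerGradX F x w ×ˢ (Set.univ : Set ℝ)) ⊆ kerSet (A₂' f₀ F x w))
    (h3 : kerSet (A₁' f₀ F x w) ∩ Δ₁ F x w ⊆ kerSet (A₂' f₀ F x w))
    (h4 : kerSet (hessXX f₀ x w) ∩ Δ₂ F x w ⊆ kerSet (hessWX f₀ x w)) :
    ∃ H : Euc n ≃L[ℝ] Euc n, (∀ v, H v = hessXX f₀ x w v) ∧
      0 < ⟪gradX F x w, H.symm (gradX F x w)⟫ := by
  have hA1 : ∀ v γ, (v, γ) ∈ kerSet (A₁' f₀ F x w) ↔ hessXX f₀ x w v + γ • gradX F x w = 0 :=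
    fun v γ => by simp [kerSet, A₁']
  have hzero : ∀ a : Euc n × ℝ, a ∈ kerSet (A₁' f₀ F x w) → a ∈ kerSet (A₂' f₀ F x w) → a = 0 :=
    fun a ha ha' => by
      have : a ∈ kerSet (A₁' f₀ F x w) ∩ kerSet (A₂' f₀ F x w) := ⟨ha, ha'⟩
      rwa [h1] at this
  have hinj : Function.Injective (hessXX f₀ x w) := by
    rw [injective_iff_map_eq_zero]
    intro v hv
    have hk : (v, (0 : ℝ)) ∈ kerSet (A₁' f₀ F x w) := by rw [hA1]; simp [hv]
    have hk2 : (v, (0 : ℝ)) ∈ kerSet (A₂' f₀ F x w) := by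
      -- Each sign of `⟪∇ₓF, v⟫` is covered by one of the three inclusions.
      rcases lt_trichotomy ⟪gradX F x w, v⟫ 0 with h | h | h
      · have : hessWX f₀ x w v = 0 := h4 ⟨hv, h⟩
        simp [kerSet, A₂', this]
      · exact h2 ⟨hk, h, trivial⟩
      · exact h3 ⟨hk, h, le_rfl⟩
    exact congrArg Prod.fst (hzero _ hk hk2)
  let H : Euc n ≃L[ℝ] Euc n := (LinearEquiv.ofInjectiveEndo _ hinj).toContinuousLinearEquiv
  have hH : ∀ v, H v = hessXX f₀ x w v := fun v => rfl
  refine ⟨H, hH, ?_⟩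
  -- If `c ≤ 0`, this nonzero kernel vector meets the sign condition of `h3` or `h2`, so it also
  -- lies in `ker A₂'`, contradicting `h1`.
  have hk : (-H.symm (gradX F x w), (1 : ℝ)) ∈ kerSet (A₁' f₀ F x w) := by
    rw [hA1, ← hH]; simp
  by_contra hneg
  have hk2 : (-H.symm (gradX F x w), (1 : ℝ)) ∈ kerSet (A₂' f₀ F x w) := by
    rcases (not_lt.1 hneg).lt_or_eq with h | h
    · exact h3 ⟨hk, by rw [inner_neg_right]; linarith, zero_le_one⟩
    · refine h2 ⟨hk, ?_, trivial⟩
      change ⟪gradX F x w, -H.symm (gradX F x w)⟫ = 0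
      rw [inner_neg_right, h, neg_zero]
  exact one_ne_zero (congrArg Prod.snd (hzero _ hk hk2))

end Sufficiency

theorem theorem4p2 {n d : ℕ} (f₀ F : Euc n × Euc d → ℝ)
    (hf₀ : ContDiff ℝ 2 f₀) (hF : ContDiff ℝ 2 F)
    (xb : Euc n) (wb : Euc d)
    (hx : xb ∈ stationarySet f₀ F wb)
    (hMFCQ : F (xb, wb) = 0 → gradX F xb wb ≠ 0)
    (hFb : F (xb, wb) = 0)
    (lam : ℝ) (hlam : IsLagrangeMultiplier f₀ F xb wb lam) (hlam0 : lam = 0) :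
    (LocallyLipschitzLike (stationarySet f₀ F) wb xb →
      kerSet (A₁' f₀ F xb wb) ∩ Δ₃ F xb wb ⊆ kerSet (A₂' f₀ F xb wb)) ∧
    ((kerSet (A₁' f₀ F xb wb) ∩ kerSet (A₂' f₀ F xb wb) = {0} ∧
      kerSet (A₁' f₀ F xb wb) ∩ (kerGradX F xb wb ×ˢ (Set.univ : Set ℝ)) ⊆
        kerSet (A₂' f₀ F xb wb) ∧
      kerSet (A₁' f₀ F xb wb) ∩ Δ₁ F xb wb ⊆ kerSet (A₂' f₀ F xb wb) ∧
      kerSet (hessXX f₀ xb wb) ∩ Δ₂ F xb wb ⊆ kerSet (hessWX f₀ xb wb)) →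
      LocallyLipschitzLike (stationarySet f₀ F) wb xb) := by
  have h0 : gradX f₀ xb wb = 0 := by simpa [hlam0] using hlam.2
  have hg := hMFCQ hFb
  refine ⟨fun hL a ha => ?_, fun ⟨h1, h2, h3, h4⟩ => ?_⟩
  · exact eq_zero_of_locallyLipschitzLike hL hx fun ε hε =>
      eventually_inner_A₂'_le hf₀ hF (p₀ := (xb, wb)) hg h0 hFb ha.1 ha.2 hε
  · obtain ⟨H, hH, hc⟩ := exists_hessXX_equiv h1 h2 h3 h4
    exact locallyLipschitzLike_stationarySet hf₀ hF hg h0 hFb H hH hc
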